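/- Let $A$ be a complex Banach algebra with unit $1\neq 0$. Write $\sigma(a)$ for the spectrum of $a\in A$, and call $a$ quasinilpotent if $\sigma(a)=\{0\}$. For $a,b\in A$ let $C_{a,b}:A\to A$ be the bounded operator $C_{a,b}x=ax-xb$, let $\rho(a,b)=\limsup_{n\to\infty}\|C_{a,b}^n1\|^{1/n}$, and let $d(a,b)=\max\{\rho(a,b),\rho(b,a)\}$. (1) If $a,b\in A$ and $\sigma(a)$ is finite, then $d(a,b)=0$ if and only if there exists $c\in A$, commuting with both $a$ and $b$, such that $a-c$ and $b-c$ are quasinilpotent. (2) Suppose that $A$ is semisimple (its Jacobson radical is $\{0\}$) and let $\operatorname{Soc}(A)$ be the socle of $A$, the sum of its minimal left ideals. If $a,b\in\operatorname{Soc}(A)$, then $d(a,b)=0$ if and only if there exists $c\in\operatorname{Soc}(A)$, commuting with both $a$ and $b$, such that $a-c$ and $b-c$ are nilpotent. -/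

import Mathlib

open Filter

namespace SpectralSemidistance

noncomputable section

/-- The bounded operator `C_{a,b} = L_a - R_b` on `A`, that is `x ↦ a * x - x * b`. -/
def commutatorOp {A : Type*} [NormedRing A] [NormedAlgebra ℂ A] (a b : A) : A →L[ℂ] A :=
  ContinuousLinearMap.mul ℂ A a - (ContinuousLinearMap.mul ℂ A).flip b

/-- `ρ(a,b) = limsup_n ‖C_{a,b}^n 1‖^{1/n}`. The sequence is bounded, since
`‖C_{a,b}^n 1‖ ≤ (‖a‖ + ‖b‖)^n * ‖1‖`, so this is the genuine upper limit. -/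
def rho {A : Type*} [NormedRing A] [NormedAlgebra ℂ A] (a b : A) : ℝ :=
  limsup (fun n : ℕ => ‖(commutatorOp a b ^ n) 1‖ ^ (1 / (n : ℝ))) atTop

/-- The spectral semidistance `d(a,b)`. -/
def specDist {A : Type*} [NormedRing A] [NormedAlgebra ℂ A] (a b : A) : ℝ :=
  max (rho a b) (rho b a)

/-- `a` is quasinilpotent when its spectrum is `{0}`. -/
def IsQuasinilpotent {A : Type*} [NormedRing A] [NormedAlgebra ℂ A] (a : A) : Prop :=
  spectrum ℂ a = {0}

/-- The socle: the sum of all minimal left ideals. (`Ideal A` is the lattice of left ideals of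
`A`, and its atoms are the minimal nonzero ones; over a ring with zero Jacobson radical the
minimal right ideals have the same sum.) -/
def socle (A : Type*) [Ring A] : Ideal A :=
  sSup {I : Ideal A | IsAtom I}

end

end SpectralSemidistance

namespace SpectralSemidistance

open Polynomial Topology

/-! The argument is phrased through sequences whose `n`-th root of the norm tends to `0`
(`HasZeroGrowth`). For `x ^ n` this is quasinilpotence (`isQuasinilpotent_iff`); for the iterates of
`C_{a,b}` on `1` it is `ρ(a,b) = 0` (`rho_eq_zero_iff`).

If `c` commutes with `a` and `b`, replacing them by `a - c` and `b - c` does not change the iterates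
on `1`, and their binomial expansion is small when both differences are quasinilpotent.

Conversely, let `σ(a)` be finite, with spectral idempotents `p z`, and put `c = ∑ z • p z`. The
idempotents come from Lagrange polynomials in `a`, corrected to exact idempotents by a Catalan
series. To see that they commute with `b`, consider the local spectral spaces of all `x` for which
`(a - z) ^ n * x` has vanishing growth. Distance zero makes these the same for `a` and `b`; they are
stable under left multiplication by `b`, and for distinct points they meet in `0`. Hence `p w * b *
p z = 0` for `w ≠ z`, so `b` is block diagonal and `b - c` is quasinilpotent
(`exists_common_spectral_part`).

An element of the socle lies in a left ideal of finite length. The chain conditions there give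
finite spectrum (`finite_spectrum`) and turn quasinilpotence into nilpotence
(`isNilpotent_of_hasZeroGrowth`). Since `c` is a left multiple of `a`, it stays in the socle. -/

/-- A sequence whose norm is bounded by a multiple of `ε ^ n`, for each `ε > 0`. -/
def HasZeroGrowth {E : Type*} [Norm E] (u : ℕ → E) : Prop :=
  ∀ ε : ℝ, 0 < ε → ∃ M : ℝ, ∀ n, ‖u n‖ ≤ M * ε ^ n

/-! ### Calculus of sequences with vanishing growth. -/

namespace HasZeroGrowth

lemma add {E : Type*} [SeminormedAddCommGroup E] {u v : ℕ → E} (hu : HasZeroGrowth u)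
    (hv : HasZeroGrowth v) : HasZeroGrowth (fun n => u n + v n) := by
  intro ε hε
  obtain ⟨M, hM⟩ := hu ε hε
  obtain ⟨N, hN⟩ := hv ε hε
  refine ⟨M + N, fun n => (norm_add_le _ _).trans ?_⟩
  rw [add_mul]
  exact add_le_add (hM n) (hN n)

/-- A product with an exponentially bounded sequence. -/
lemma of_norm_le {E F : Type*} [SeminormedAddCommGroup E] [SeminormedAddCommGroup F]
    {u : ℕ → E} {v : ℕ → F} (hu : HasZeroGrowth u) {K R : ℝ} (hK : 0 ≤ K) (hR : 0 ≤ R)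
    (h : ∀ n, ‖v n‖ ≤ K * R ^ n * ‖u n‖) : HasZeroGrowth v := by
  intro ε hε
  -- The factor `(R + 1) ^ n` absorbs `R ^ n`; the `+ 1` keeps the denominator positive when `R =
  -- 0`.
  obtain ⟨M, hM⟩ := hu (ε / (R + 1)) (by positivity)
  have hM0 : 0 ≤ M := by simpa using (norm_nonneg _).trans (hM 0)
  refine ⟨K * M, fun n => (h n).trans ?_⟩
  calc K * R ^ n * ‖u n‖ ≤ K * (R + 1) ^ n * (M * (ε / (R + 1)) ^ n) := by
        gcongr
        · linarith
        · exact hM n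
    _ = K * M * ε ^ n := by
        rw [div_pow]
        field_simp

lemma mul_left {A : Type*} [SeminormedRing A] {u : ℕ → A} (hu : HasZeroGrowth u) (x : A) :
    HasZeroGrowth (fun n => x * u n) :=
  hu.of_norm_le (norm_nonneg x) zero_le_one fun n => by simpa using norm_mul_le x (u n)

lemma mul_right {A : Type*} [SeminormedRing A] {u : ℕ → A} (hu : HasZeroGrowth u) (x : A) :
    HasZeroGrowth (fun n => u n * x) :=
  hu.of_norm_le (norm_nonneg x) zero_le_one fun n => by
    simpa [mul_comm] using norm_mul_le (u n) x

/-- Binomial convolution preserves vanishing growth. -/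
lemma binomial {A : Type*} [SeminormedRing A] {u v : ℕ → A} (hu : HasZeroGrowth u)
    (hv : HasZeroGrowth v) : HasZeroGrowth (fun n =>
      ∑ m ∈ Finset.HasAntidiagonal.antidiagonal n, n.choose m.1 • (u m.1 * v m.2)) := by
  intro ε hε
  obtain ⟨M, hM⟩ := hu (ε / 2) (by positivity)
  obtain ⟨N, hN⟩ := hv (ε / 2) (by positivity)
  have hM0 : 0 ≤ M := by simpa using (norm_nonneg _).trans (hM 0)
  refine ⟨M * N, fun n => (norm_sum_le _ _).trans ?_⟩
  calc ∑ m ∈ Finset.HasAntidiagonal.antidiagonal n, ‖n.choose m.1 • (u m.1 * v m.2)‖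
      ≤ ∑ m ∈ Finset.HasAntidiagonal.antidiagonal n, n.choose m.1 • (M * N * ((ε / 2) ^ m.1 * (ε / 2) ^ m.2)) := by
        refine Finset.sum_le_sum fun m _ => (norm_nsmul_le).trans ?_
        rw [nsmul_eq_mul]
        gcongr
        calc ‖u m.1 * v m.2‖ ≤ ‖u m.1‖ * ‖v m.2‖ := norm_mul_le _ _
          _ ≤ (M * (ε / 2) ^ m.1) * (N * (ε / 2) ^ m.2) := by
            gcongr
            · exact hM _
            · exact hN _
          _ = _ := by ring
    _ = M * N * ε ^ n := by
        have h := (Commute.all (ε / 2) (ε / 2)).add_pow' n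
        rw [add_halves] at h
        rw [h, Finset.mul_sum]
        refine Finset.sum_congr rfl fun m _ => ?_
        simp only [nsmul_eq_mul]
        ring

/-- The constant sequence `x` would itself have vanishing growth, so its norm is at most `M * (1 /
2) ^ n` for all `n`. -/
lemma eq_zero_of_norm_le {E F : Type*} [SeminormedAddCommGroup E] [NormedAddCommGroup F]
    {u : ℕ → E} (hu : HasZeroGrowth u) {x : F} {K R : ℝ} (hK : 0 ≤ K) (hR : 0 ≤ R)
    (h : ∀ n, ‖x‖ ≤ K * R ^ n * ‖u n‖) : x = 0 := by
  obtain ⟨M, hM⟩ := hu.of_norm_le (v := fun _ => x) hK hR h (1 / 2) (by norm_num)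
  have ht : Tendsto (fun n : ℕ => M * (1 / 2 : ℝ) ^ n) atTop (𝓝 (M * 0)) :=
    (tendsto_pow_atTop_nhds_zero_of_lt_one (by norm_num) (by norm_num)).const_mul M
  have := ge_of_tendsto' ht hM
  rw [mul_zero] at this
  exact norm_le_zero_iff.mp this

lemma tendsto_root {E : Type*} [SeminormedAddCommGroup E] {u : ℕ → E} (hu : HasZeroGrowth u) :
    Tendsto (fun n : ℕ => ‖u n‖ ^ (1 / (n : ℝ))) atTop (𝓝 0) := by
  rw [tendsto_order]
  refine ⟨fun a ha => Eventually.of_forall fun n => ha.trans_le (by positivity), fun δ hδ => ?_⟩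
  obtain ⟨M, hM⟩ := hu (δ / 4) (by positivity)
  have hM0 : 0 ≤ M := by simpa using (norm_nonneg _).trans (hM 0)
  have h2 : ∀ᶠ n : ℕ in atTop, M ≤ 2 ^ n :=
    (tendsto_pow_atTop_atTop_of_one_lt (by norm_num : (1 : ℝ) < 2)).eventually_ge_atTop M
  filter_upwards [h2, eventually_gt_atTop 0] with n hn hn0
  have hle : ‖u n‖ ≤ (δ / 2) ^ n := by
    calc ‖u n‖ ≤ M * (δ / 4) ^ n := hM n
      _ ≤ 2 ^ n * (δ / 4) ^ n := by gcongr
      _ = (δ / 2) ^ n := by rw [← mul_pow]; ring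
  calc ‖u n‖ ^ (1 / (n : ℝ)) ≤ ((δ / 2) ^ n) ^ (1 / (n : ℝ)) :=
        Real.rpow_le_rpow (norm_nonneg _) hle (by positivity)
    _ = δ / 2 := by
        rw [one_div]
        exact Real.pow_rpow_inv_natCast (by positivity) hn0.ne'
    _ < δ := by linarith

lemma of_eventually_root_lt {E : Type*} [SeminormedAddCommGroup E] {u : ℕ → E}
    (h : ∀ ε : ℝ, 0 < ε → ∀ᶠ n : ℕ in atTop, ‖u n‖ ^ (1 / (n : ℝ)) < ε) : HasZeroGrowth u := by
  intro ε hε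
  obtain ⟨N, hN⟩ := eventually_atTop.mp ((h ε hε).and (eventually_gt_atTop 0))
  refine ⟨1 + ∑ k ∈ Finset.range N, ‖u k‖ / ε ^ k, fun n => ?_⟩
  have hs : 0 ≤ ∑ k ∈ Finset.range N, ‖u k‖ / ε ^ k := Finset.sum_nonneg fun _ _ => by positivity
  rcases lt_or_ge n N with hn | hn
  · have := Finset.single_le_sum (f := fun k => ‖u k‖ / ε ^ k)
      (fun _ _ => by positivity) (Finset.mem_range.mpr hn)
    have h' : ‖u n‖ / ε ^ n ≤ 1 + ∑ k ∈ Finset.range N, ‖u k‖ / ε ^ k := by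
      linarith
    rwa [div_le_iff₀ (by positivity)] at h'
  · obtain ⟨h1, h0⟩ := hN n hn
    have h2 : ‖u n‖ ≤ ε ^ n := by
      calc ‖u n‖ = (‖u n‖ ^ (1 / (n : ℝ))) ^ n := by
            rw [one_div, Real.rpow_inv_natCast_pow (norm_nonneg _) h0.ne']
        _ ≤ ε ^ n := by gcongr
    nlinarith [pow_pos hε n]

end HasZeroGrowth

/-! ### Powers with vanishing growth. -/

section Ring

variable {A : Type*} [NormedRing A]

lemma hasZeroGrowth_pow_add {x y : A} (h : Commute x y) (hx : HasZeroGrowth (x ^ ·))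
    (hy : HasZeroGrowth (y ^ ·)) : HasZeroGrowth ((x + y) ^ ·) := by
  simp only [h.add_pow']
  exact hx.binomial hy

lemma norm_pow_le_norm_one_mul (x : A) (n : ℕ) : ‖x ^ n‖ ≤ ‖(1 : A)‖ * ‖x‖ ^ n := by
  induction n with
  | zero => simp
  | succ n ih =>
    rw [pow_succ, pow_succ, ← mul_assoc]
    exact (norm_mul_le _ _).trans (by gcongr)

lemma hasZeroGrowth_pow_mul {x y : A} (h : Commute x y) (hx : HasZeroGrowth (x ^ ·)) :
    HasZeroGrowth ((x * y) ^ ·) := by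
  refine hx.of_norm_le (norm_nonneg (1 : A)) (norm_nonneg y) fun n => ?_
  simp only [h.mul_pow]
  calc ‖x ^ n * y ^ n‖ ≤ ‖x ^ n‖ * ‖y ^ n‖ := norm_mul_le _ _
    _ ≤ ‖x ^ n‖ * (‖(1 : A)‖ * ‖y‖ ^ n) := by gcongr; exact norm_pow_le_norm_one_mul y n
    _ = _ := by ring

lemma hasZeroGrowth_pow_neg {x : A} (hx : HasZeroGrowth (x ^ ·)) :
    HasZeroGrowth ((-x) ^ ·) := by
  simpa using hasZeroGrowth_pow_mul (Commute.neg_one_right x) hx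

/-- This turns approximate identities between idempotents into exact ones: orthogonality and
completeness of the spectral idempotents are both obtained from it. -/
lemma eq_zero_of_isIdempotentElem {p : A} (hp : IsIdempotentElem p)
    (h : HasZeroGrowth (p ^ ·)) : p = 0 := by
  refine h.eq_zero_of_norm_le (norm_nonneg p) zero_le_one fun n => ?_
  calc ‖p‖ = ‖p * p ^ n‖ := by rw [← pow_succ', hp.pow_succ_eq]
    _ ≤ ‖p‖ * 1 ^ n * ‖p ^ n‖ := by simpa using norm_mul_le p (p ^ n)

lemma hasZeroGrowth_pow_of_isNilpotent {x : A} (hx : IsNilpotent x) : HasZeroGrowth (x ^ ·) := by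
  obtain ⟨k, hk⟩ := hx
  intro ε hε
  refine ⟨∑ j ∈ Finset.range k, ‖x ^ j‖ / ε ^ j, fun n => ?_⟩
  rcases lt_or_ge n k with hn | hn
  · have := Finset.single_le_sum (f := fun j => ‖x ^ j‖ / ε ^ j)
      (fun _ _ => by positivity) (Finset.mem_range.mpr hn)
    rwa [div_le_iff₀ (by positivity)] at this
  · simp only [pow_eq_zero_of_le hn hk, norm_zero]
    exact mul_nonneg (Finset.sum_nonneg fun _ _ => by positivity) (by positivity)

end Ring

/-! ### Vanishing growth of powers and the spectrum. -/

section Spectrum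

variable {A : Type*} [NormedRing A] [NormedAlgebra ℂ A] [CompleteSpace A]

lemma eq_zero_of_mem_spectrum {x : A} (hx : HasZeroGrowth (x ^ ·)) {z : ℂ}
    (hz : z ∈ spectrum ℂ x) : z = 0 := by
  by_contra h0
  have h1 : (1 : ℂ) = 0 := by
    refine hx.eq_zero_of_norm_le (norm_nonneg (1 : A)) (norm_nonneg z⁻¹) fun n => ?_
    have h := spectrum.norm_le_norm_mul_of_mem (spectrum.pow_mem_pow x n hz)
    rw [norm_pow] at h
    have hz' : 0 < ‖z‖ := norm_pos_iff.mpr h0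
    calc ‖(1 : ℂ)‖ = ‖z⁻¹‖ ^ n * ‖z‖ ^ n := by
          rw [← mul_pow, norm_inv, inv_mul_cancel₀ hz'.ne']; simp
      _ ≤ ‖z⁻¹‖ ^ n * (‖x ^ n‖ * ‖(1 : A)‖) := by gcongr
      _ = _ := by ring
  exact one_ne_zero h1

lemma isUnit_algebraMap_add {x : A} (hx : HasZeroGrowth (x ^ ·)) {z : ℂ} (hz : z ≠ 0) :
    IsUnit (algebraMap ℂ A z + x) := by
  by_contra h
  have : -z ∈ spectrum ℂ x := by
    rw [spectrum.mem_iff, map_neg, ← neg_add', IsUnit.neg_iff]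
    exact h
  exact hz (neg_eq_zero.mp (eq_zero_of_mem_spectrum hx this))

lemma isQuasinilpotent_iff [Nontrivial A] {x : A} :
    IsQuasinilpotent x ↔ HasZeroGrowth (x ^ ·) := by
  constructor
  · intro h
    have hr : spectralRadius ℂ x = 0 := by
      have h : spectrum ℂ x = {0} := h
      simp [spectralRadius, h]
    have ht := spectrum.pow_norm_pow_one_div_tendsto_nhds_spectralRadius x
    rw [hr] at ht
    refine HasZeroGrowth.of_eventually_root_lt fun ε hε => ?_
    filter_upwards [ht.eventually_lt_const (ENNReal.ofReal_pos.mpr hε)] with n hn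
    exact (ENNReal.ofReal_lt_ofReal_iff hε).mp hn
  · intro h
    refine Set.Nonempty.subset_singleton_iff (spectrum.nonempty x) |>.mp fun z hz => ?_
    exact eq_zero_of_mem_spectrum h hz

end Spectrum

/-! ### Iterates of `C_{a,b}` on `1`. -/

section Commutator

variable {A : Type*} [NormedRing A] [NormedAlgebra ℂ A]

lemma commutatorOp_apply (a b x : A) : commutatorOp a b x = a * x - x * b := rfl

lemma norm_commutatorOp_pow_le (a b : A) (n : ℕ) :
    ‖(commutatorOp a b ^ n) 1‖ ≤ ‖(1 : A)‖ * (‖a‖ + ‖b‖) ^ n := by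
  induction n with
  | zero => simp
  | succ n ih =>
    rw [pow_succ', mul_apply_eq_comp, commutatorOp_apply]
    set y := (commutatorOp a b ^ n) 1
    calc ‖a * y - y * b‖ ≤ ‖a‖ * ‖y‖ + ‖y‖ * ‖b‖ :=
          (norm_sub_le _ _).trans (add_le_add (norm_mul_le _ _) (norm_mul_le _ _))
      _ = ‖y‖ * (‖a‖ + ‖b‖) := by ring
      _ ≤ (‖(1 : A)‖ * (‖a‖ + ‖b‖) ^ n) * (‖a‖ + ‖b‖) := by gcongr
      _ = _ := by ring

lemma isBoundedUnder_root (a b : A) : IsBoundedUnder (· ≤ ·) atTop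
    (fun n : ℕ => ‖(commutatorOp a b ^ n) 1‖ ^ (1 / (n : ℝ))) := by
  refine isBoundedUnder_of_eventually_le (a := (‖(1 : A)‖ + 1) * (‖a‖ + ‖b‖)) ?_
  filter_upwards [eventually_gt_atTop 0] with n hn
  have h : ‖(commutatorOp a b ^ n) 1‖ ≤ ((‖(1 : A)‖ + 1) * (‖a‖ + ‖b‖)) ^ n := by
    refine (norm_commutatorOp_pow_le a b n).trans ?_
    rw [mul_pow]
    gcongr
    calc ‖(1 : A)‖ ≤ ‖(1 : A)‖ + 1 := by linarith
      _ ≤ (‖(1 : A)‖ + 1) ^ n := le_self_pow₀ (by linarith [norm_nonneg (1 : A)]) hn.ne'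
  calc _ ≤ (((‖(1 : A)‖ + 1) * (‖a‖ + ‖b‖)) ^ n) ^ (1 / (n : ℝ)) :=
        Real.rpow_le_rpow (norm_nonneg _) h (by positivity)
    _ = _ := by
      rw [one_div]
      exact Real.pow_rpow_inv_natCast (by positivity) hn.ne'

lemma rho_nonneg (a b : A) : 0 ≤ rho a b :=
  le_limsup_of_frequently_le (Frequently.of_forall fun n => by positivity)
    (isBoundedUnder_root a b)

lemma rho_eq_zero_iff (a b : A) :
    rho a b = 0 ↔ HasZeroGrowth (fun n => (commutatorOp a b ^ n) 1) := by
  constructor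
  · intro h
    refine HasZeroGrowth.of_eventually_root_lt fun ε hε => ?_
    exact eventually_lt_of_limsup_lt (h.trans_lt hε) (isBoundedUnder_root a b)
  · intro h
    exact h.tendsto_root.limsup_eq

lemma specDist_eq_zero_iff (a b : A) : specDist a b = 0 ↔
    HasZeroGrowth (fun n => (commutatorOp a b ^ n) 1) ∧
      HasZeroGrowth (fun n => (commutatorOp b a ^ n) 1) := by
  rw [← rho_eq_zero_iff, ← rho_eq_zero_iff, specDist]
  constructor
  · intro h
    exact ⟨le_antisymm (h ▸ le_max_left _ _) (rho_nonneg a b),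
      le_antisymm (h ▸ le_max_right _ _) (rho_nonneg b a)⟩
  · rintro ⟨h1, h2⟩
    simp [h1, h2]

/-- Left multiplication by `b` is `C_{b,a}` plus right multiplication by `a`, and these commute; the
binomial theorem is applied to `1`. -/
lemma mul_pow_eq_sum_commutatorOp (a b : A) (n : ℕ) : b ^ n =
    ∑ m ∈ Finset.HasAntidiagonal.antidiagonal n, n.choose m.1 • ((commutatorOp b a ^ m.1) 1 * a ^ m.2) := by
  have hmul : ∀ k j, (commutatorOp b a ^ k) (a ^ j) = (commutatorOp b a ^ k) 1 * a ^ j := by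
    intro k j
    induction k with
    | zero => simp
    | succ k ih =>
      rw [pow_succ', mul_apply_eq_comp, mul_apply_eq_comp, ih,
        commutatorOp_apply, commutatorOp_apply, sub_mul, mul_assoc, mul_assoc, mul_assoc,
        (Commute.pow_self a j).eq]
  have hl : ∀ k, ((ContinuousLinearMap.mul ℂ A b) ^ k) 1 = b ^ k := by
    intro k
    induction k with
    | zero => simp
    | succ k ih => rw [pow_succ', mul_apply_eq_comp, ih, pow_succ']; rfl
  have hr : ∀ k, (((ContinuousLinearMap.mul ℂ A).flip a) ^ k) 1 = a ^ k := by
    intro k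
    induction k with
    | zero => simp
    | succ k ih => rw [pow_succ', mul_apply_eq_comp, ih, pow_succ]; rfl
  have hc : Commute (commutatorOp b a) ((ContinuousLinearMap.mul ℂ A).flip a) := by
    refine Commute.sub_left ?_ (Commute.refl _)
    ext x
    simp [mul_assoc]
  have h := congrArg (fun T : A →L[ℂ] A => T 1) (hc.add_pow' n)
  simp only [sum_apply, smul_apply,
    mul_apply_eq_comp, hr, hmul] at h
  rw [← h, ← hl, commutatorOp, sub_add_cancel]

/-- Binomial theorem for the commuting operators of left multiplication by `a` and right
multiplication by `-b`. -/
lemma commutatorOp_pow_one_eq_sum (a b : A) (n : ℕ) : (commutatorOp a b ^ n) 1 =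
    ∑ m ∈ Finset.HasAntidiagonal.antidiagonal n, n.choose m.1 • (a ^ m.1 * (-b) ^ m.2) := by
  have hl : ∀ k x, ((ContinuousLinearMap.mul ℂ A a) ^ k) x = a ^ k * x := by
    intro k x
    induction k with
    | zero => simp
    | succ k ih => rw [pow_succ', mul_apply_eq_comp, ih, pow_succ', mul_assoc]; rfl
  have hr : ∀ k, ((-(ContinuousLinearMap.mul ℂ A).flip b) ^ k) 1 = (-b) ^ k := by
    intro k
    induction k with
    | zero => simp
    | succ k ih =>
      rw [pow_succ', mul_apply_eq_comp, ih, pow_succ, mul_neg]; rfl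
  have hc : Commute (ContinuousLinearMap.mul ℂ A a) (-(ContinuousLinearMap.mul ℂ A).flip b) := by
    refine Commute.neg_right ?_
    ext x
    simp [mul_assoc]
  have h := congrArg (fun T : A →L[ℂ] A => T 1) (hc.add_pow' n)
  simp only [sum_apply, smul_apply,
    mul_apply_eq_comp, hr, hl] at h
  rw [← h, commutatorOp, sub_eq_add_neg]

/-- Each iterate `y` commutes with `c`, so the terms `c * y` and `y * c` cancel; the two claims are
carried through one induction. -/
lemma commutatorOp_sub_pow_one {a b c : A} (ha : Commute c a) (hb : Commute c b) (n : ℕ) :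
    (commutatorOp (a - c) (b - c) ^ n) 1 = (commutatorOp a b ^ n) 1 ∧
      Commute c ((commutatorOp a b ^ n) 1) := by
  induction n with
  | zero => simp
  | succ n ih =>
    obtain ⟨h1, h2⟩ := ih
    simp only [pow_succ', mul_apply_eq_comp, h1, commutatorOp_apply]
    refine ⟨?_, (ha.mul_right h2).sub_right (h2.mul_right hb)⟩
    rw [sub_mul, mul_sub, h2.eq]
    abel

/-- A common commuting perturbation by elements with vanishing growth gives distance zero. -/
lemma hasZeroGrowth_commutatorOp {a b c : A} (ha : Commute c a) (hb : Commute c b)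
    (hac : HasZeroGrowth ((a - c) ^ ·)) (hbc : HasZeroGrowth ((b - c) ^ ·)) :
    HasZeroGrowth (fun n => (commutatorOp a b ^ n) 1) := by
  simp only [← (commutatorOp_sub_pow_one ha hb _).1, commutatorOp_pow_one_eq_sum]
  exact hac.binomial (hasZeroGrowth_pow_neg hbc)

lemma specDist_eq_zero_of_commute {a b c : A} (ha : Commute c a) (hb : Commute c b)
    (hac : HasZeroGrowth ((a - c) ^ ·)) (hbc : HasZeroGrowth ((b - c) ^ ·)) :
    specDist a b = 0 :=
  (specDist_eq_zero_iff a b).mpr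
    ⟨hasZeroGrowth_commutatorOp ha hb hac hbc, hasZeroGrowth_commutatorOp hb ha hbc hac⟩

end Commutator

/-! ### Lifting approximate idempotents in a commutative Banach algebra. -/

section Idempotent

variable {B : Type*} [NormedCommRing B] [CompleteSpace B]

/-- The Catalan series solves `y = s + y ^ 2` for `s` with vanishing growth. -/
lemma exists_eq_add_sq {s : B} (hs : HasZeroGrowth (s ^ ·)) :
    ∃ w : B, s * w = s + (s * w) ^ 2 := by
  set f : ℕ → B := fun n => catalan n • s ^ n with hf
  have hsum : Summable fun n => ‖f n‖ := by
    obtain ⟨M, hM⟩ := hs (1 / 8) (by norm_num)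
    refine Summable.of_nonneg_of_le (fun _ => norm_nonneg _) (fun n => ?_)
      ((summable_geometric_of_lt_one (by norm_num : (0 : ℝ) ≤ 1 / 2) (by norm_num)).mul_left M)
    -- The bound `4 ^ n` against growth rate `1 / 8` leaves a geometric series of ratio `1 / 2`.
    have hc : (catalan n : ℝ) ≤ 4 ^ n := by
      have h1 : catalan n ≤ n.centralBinom := by
        rw [catalan_eq_centralBinom_div]; exact Nat.div_le_self _ _
      have h2 : n.centralBinom ≤ 2 ^ (2 * n) := Nat.choose_le_two_pow _ _
      rw [pow_mul] at h2
      exact_mod_cast h1.trans h2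
    calc ‖f n‖ ≤ catalan n * ‖s ^ n‖ := norm_nsmul_le
      _ ≤ 4 ^ n * (M * (1 / 8) ^ n) := by gcongr; exact hM n
      _ = M * (1 / 2) ^ n := by
        rw [mul_left_comm, ← mul_pow]; norm_num
  -- The generating function identity `C = 1 + s * C ^ 2`, from the Catalan recursion and the Cauchy
  -- product; multiplying by `s` gives the claim.
  have hC : ∑' n, f n = 1 + s * ((∑' n, f n) * ∑' n, f n) := by
    rw [tsum_mul_tsum_eq_tsum_sum_antidiagonal_of_summable_norm hsum hsum]
    have hs2 := (summable_norm_sum_mul_antidiagonal_of_summable_norm hsum hsum).of_norm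
    rw [hsum.of_norm.tsum_eq_zero_add, ← hs2.tsum_mul_left]
    congr 1
    · simp [hf]
    · refine tsum_congr fun n => ?_
      simp only [hf, catalan_succ', Finset.sum_smul, Finset.mul_sum]
      refine Finset.sum_congr rfl fun m hm => ?_
      rw [← Finset.HasAntidiagonal.mem_antidiagonal.mp hm]
      simp only [nsmul_eq_mul, Nat.cast_mul]
      ring
  refine ⟨∑' n, f n, ?_⟩
  set c := ∑' n, f n
  linear_combination s * hC

variable [NormedAlgebra ℂ B]

/-- An element that is idempotent up to vanishing growth lifts to an idempotent. -/
lemma exists_isIdempotentElem_sub {e : B} (he : HasZeroGrowth ((e ^ 2 - e) ^ ·)) :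
    ∃ p : B, IsIdempotentElem p ∧ HasZeroGrowth ((p - e) ^ ·) := by
  -- With `q = e ^ 2 - e`, the discriminant is `D = 1 + 4 * q = (1 - 2 * e) ^ 2`. For `p = e + (1 -
  -- 2 * e) * y` one finds `p ^ 2 - p = q - D * (y - y ^ 2)`, so `y` must solve `y = q * D⁻¹ + y ^
  -- 2`.
  have hu : IsUnit (1 + 4 * (e ^ 2 - e)) := by
    have h4 : HasZeroGrowth (((e ^ 2 - e) * 4) ^ ·) := hasZeroGrowth_pow_mul (Commute.all _ _) he
    have := isUnit_algebraMap_add h4 (one_ne_zero (α := ℂ))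
    rwa [map_one, mul_comm _ (4 : B)] at this
  obtain ⟨v, hv⟩ := hu.exists_right_inv
  obtain ⟨w, hw⟩ := exists_eq_add_sq (hasZeroGrowth_pow_mul (Commute.all _ v) he)
  refine ⟨e + (1 - 2 * e) * ((e ^ 2 - e) * v * w), ?_, ?_⟩
  · rw [IsIdempotentElem]
    linear_combination -(e ^ 2 - e) * hv - (1 + 4 * (e ^ 2 - e)) * hw
  · have h : e + (1 - 2 * e) * ((e ^ 2 - e) * v * w) - e = (e ^ 2 - e) * (v * w * (1 - 2 * e)) := by
      ring
    rw [h]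
    exact hasZeroGrowth_pow_mul (Commute.all _ _) he

/-- Spectral idempotents, in a commutative algebra. -/
lemma exists_idempotents_of_comm (a : B) (s : Finset ℂ) (hs : s.Nonempty)
    (h : ∀ f : ℂ[X], (∀ z ∈ s, f.eval z = 0) → HasZeroGrowth (aeval a f ^ ·)) :
    ∃ p : ℂ → B, (∀ z ∈ s, IsIdempotentElem (p z)) ∧ ∑ z ∈ s, p z = 1 ∧
      ∀ z ∈ s, HasZeroGrowth (((a - algebraMap ℂ B z) * p z) ^ ·) := by
  classical
  set e : ℂ → ℂ[X] := Lagrange.basis s id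
  have hinj : Set.InjOn (id : ℂ → ℂ) s := Set.injOn_id _
  have hself : ∀ z ∈ s, (e z).eval z = 1 := fun z hz => Lagrange.eval_basis_self hinj hz
  have hne : ∀ z w, z ≠ w → w ∈ s → (e z).eval w = 0 := fun z w hzw hw =>
    Lagrange.eval_basis_of_ne (v := id) hzw hw
  have hex : ∀ z ∈ s, ∃ p : B, IsIdempotentElem p ∧ HasZeroGrowth ((p - aeval a (e z)) ^ ·) := by
    intro z hz
    apply exists_isIdempotentElem_sub
    have := h (e z ^ 2 - e z) fun w hw => by
      by_cases hzw : z = w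
      · subst hzw; simp [hself z hz]
      · simp [hne z w hzw hw]
    simpa using this
  choose! p hp hpe using hex
  have hsmall : ∀ z ∈ s, HasZeroGrowth (((a - algebraMap ℂ B z) * p z) ^ ·) := by
    intro z hz
    have h1 := h ((X - C z) * e z) fun w hw => by
      by_cases hzw : z = w
      · subst hzw; simp
      · simp [hne z w hzw hw]
    have h2 := hasZeroGrowth_pow_add (Commute.all _ _) h1
      (hasZeroGrowth_pow_mul (Commute.all _ (a - algebraMap ℂ B z)) (hpe z hz))
    have heq : aeval a ((X - C z) * e z) + (p z - aeval a (e z)) * (a - algebraMap ℂ B z) =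
        (a - algebraMap ℂ B z) * p z := by
      simp only [map_mul, map_sub, aeval_X, aeval_C]
      ring
    rwa [heq] at h2
  have horth : ∀ z ∈ s, ∀ w ∈ s, z ≠ w → p z * p w = 0 := by
    intro z hz w hw hzw
    -- The product differs by small terms from `e z * e w` evaluated at `a`, and that polynomial
    -- vanishes on `s`.
    refine eq_zero_of_isIdempotentElem ((hp z hz).mul (hp w hw)) ?_
    have h1 := h (e z * e w) fun x hx => by
      by_cases hzx : z = x
      · subst hzx; simp [hne w z hzw.symm hz]
      · simp [hne z x hzx hx]
    have h2 := hasZeroGrowth_pow_add (Commute.all _ _) h1 (hasZeroGrowth_pow_add (Commute.all _ _)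
      (hasZeroGrowth_pow_mul (Commute.all _ (p w)) (hpe z hz))
      (hasZeroGrowth_pow_mul (Commute.all _ (aeval a (e z))) (hpe w hw)))
    have heq : aeval a (e z * e w) + ((p z - aeval a (e z)) * p w +
        (p w - aeval a (e w)) * aeval a (e z)) = p z * p w := by
      simp only [map_mul]
      ring
    rwa [heq] at h2
  have hsumidem : IsIdempotentElem (∑ z ∈ s, p z) := by
    rw [IsIdempotentElem, Finset.sum_mul_sum]
    refine Finset.sum_congr rfl fun z hz => ?_
    rw [Finset.sum_eq_single_of_mem z hz fun w hw hwz => horth z hz w hw hwz.symm]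
    exact hp z hz
  refine ⟨p, hp, ?_, hsmall⟩
  -- The Lagrange basis sums to `1`, so the idempotent `1 - ∑ p z` is a sum of the small errors, up
  -- to sign.
  refine (sub_eq_zero.mp (eq_zero_of_isIdempotentElem hsumidem.one_sub ?_)).symm
  have hsub : ∀ t ⊆ s, HasZeroGrowth ((∑ z ∈ t, (p z - aeval a (e z))) ^ ·) := by
    intro t ht
    induction t using Finset.induction_on with
    | empty =>
      simp only [Finset.sum_empty]
      exact hasZeroGrowth_pow_of_isNilpotent IsNilpotent.zero
    | insert z t hz ih =>
      rw [Finset.sum_insert hz]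
      exact hasZeroGrowth_pow_add (Commute.all _ _) (hpe z (ht (by simp)))
        (ih fun w hw => ht (by simp [hw]))
  have h1 := hasZeroGrowth_pow_neg (hsub s subset_rfl)
  have heq : -∑ z ∈ s, (p z - aeval a (e z)) = 1 - ∑ z ∈ s, p z := by
    rw [Finset.sum_sub_distrib, ← map_sum, Lagrange.sum_basis hinj hs, map_one, neg_sub]
  rwa [heq] at h1

end Idempotent

/-! ### Spectral idempotents in a general Banach algebra. -/

section Decomposition

variable {A : Type*} [NormedRing A] [NormedAlgebra ℂ A] [CompleteSpace A] [Nontrivial A]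

/-- Spectral idempotents of an element with finite spectrum. -/
lemma exists_idempotents (a : A) (s : Finset ℂ) (hs : spectrum ℂ a = s) :
    ∃ p : ℂ → A, (∀ z ∈ s, IsIdempotentElem (p z)) ∧ (∀ z, Commute (p z) a) ∧
      (∀ z w, Commute (p z) (p w)) ∧ ∑ z ∈ s, p z = 1 ∧
      ∀ z ∈ s, HasZeroGrowth (((a - algebraMap ℂ A z) * p z) ^ ·) := by
  -- The commutative case is applied in the closed subalgebra generated by `a`. Its norm is that of
  -- `A`, so growth may be estimated in `A`, where the spectral mapping theorem uses the spectrum of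
  -- `a` in `A`.
  let _ : NormedCommRing (Algebra.elemental ℂ a) :=
    { (inferInstance : NormedRing (Algebra.elemental ℂ a)) with mul_comm := mul_comm }
  have hne : s.Nonempty := by
    rw [← Finset.coe_nonempty, ← hs]; exact spectrum.nonempty a
  have h : ∀ f : ℂ[X], (∀ z ∈ s, f.eval z = 0) →
      HasZeroGrowth (aeval (⟨a, Algebra.elemental.self_mem ℂ a⟩ : Algebra.elemental ℂ a) f ^ ·) := by
    intro f hf
    have h1 : HasZeroGrowth (aeval a f ^ ·) := by
      rw [← isQuasinilpotent_iff, IsQuasinilpotent, spectrum.map_polynomial_aeval]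
      refine (Set.Nonempty.subset_singleton_iff ((spectrum.nonempty a).image _)).mp ?_
      rintro _ ⟨z, hz, rfl⟩
      exact hf z (by rwa [hs] at hz)
    intro ε hε
    obtain ⟨M, hM⟩ := h1 ε hε
    refine ⟨M, fun n => ?_⟩
    have hc : ((aeval (⟨a, Algebra.elemental.self_mem ℂ a⟩ : Algebra.elemental ℂ a) f :
        Algebra.elemental ℂ a) : A) = aeval a f := by
      rw [Polynomial.aeval_subalgebra_coe]
    have := hM n
    rw [← hc] at this
    exact this
  obtain ⟨p, h1, h2, h3⟩ := exists_idempotents_of_comm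
    (⟨a, Algebra.elemental.self_mem ℂ a⟩ : Algebra.elemental ℂ a) s hne h
  refine ⟨fun z => p z, fun z hz => ?_, fun z => ?_, fun z w => ?_, ?_, fun z hz => ?_⟩
  · exact congrArg Subtype.val (h1 z hz)
  · exact congrArg Subtype.val
      (mul_comm (p z) (⟨a, Algebra.elemental.self_mem ℂ a⟩ : Algebra.elemental ℂ a))
  · exact congrArg Subtype.val (mul_comm (p z) (p w))
  · have := congrArg (Subtype.val : Algebra.elemental ℂ a → A) h2
    simpa using this
  · exact h3 z hz

end Decomposition

/-! ### Local spectral spaces. -/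

section LocalSpectral

variable {A : Type*} [NormedRing A] [NormedAlgebra ℂ A]

/-- Vanishing growth of `a ^ n * x` passes from `a` to `b`. -/
lemma HasZeroGrowth.pow_mul_transfer {a b x : A}
    (h : HasZeroGrowth (fun n => (commutatorOp b a ^ n) 1))
    (hx : HasZeroGrowth (fun n => a ^ n * x)) : HasZeroGrowth (fun n => b ^ n * x) := by
  have heq : ∀ n, b ^ n * x = ∑ m ∈ Finset.HasAntidiagonal.antidiagonal n,
      n.choose m.1 • ((commutatorOp b a ^ m.1) 1 * (a ^ m.2 * x)) := by
    intro n
    rw [mul_pow_eq_sum_commutatorOp a b n, Finset.sum_mul]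
    refine Finset.sum_congr rfl fun m _ => ?_
    rw [smul_mul_assoc, mul_assoc]
  simp only [heq]
  exact h.binomial hx

/-- Subtracting the same scalar from `a` and `b` leaves the iterates on `1` unchanged, so the
transfer holds at every spectral point. -/
lemma HasZeroGrowth.sub_algebraMap_transfer {a b x : A} (z : ℂ)
    (hx : HasZeroGrowth (fun n => (a - algebraMap ℂ A z) ^ n * x))
    (h : HasZeroGrowth (fun n => (commutatorOp b a ^ n) 1)) :
    HasZeroGrowth (fun n => (b - algebraMap ℂ A z) ^ n * x) := by
  refine HasZeroGrowth.pow_mul_transfer ?_ hx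
  simp only [(commutatorOp_sub_pow_one (Algebra.commute_algebraMap_left z b)
    (Algebra.commute_algebraMap_left z a) _).1]
  exact h

/-- The local spectral spaces of distinct points meet trivially. -/
lemma eq_zero_of_hasZeroGrowth {u v x : A} {z : ℂ} (hz : z ≠ 0)
    (h : u + v = algebraMap ℂ A z) (hu : HasZeroGrowth (fun n => u ^ n * x))
    (hv : HasZeroGrowth (fun n => v ^ n * x)) : x = 0 := by
  have huv : Commute u v := by
    rw [eq_sub_of_add_eq' h]
    exact (Algebra.commute_algebraMap_right z u).sub_right (Commute.refl u)
  set K : ℝ := max ‖u‖ ‖v‖ with hK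
  have hK0 : 0 ≤ K := (norm_nonneg u).trans (le_max_left _ _)
  set w : ℕ → ℝ := fun n => ‖u ^ n * x‖ + ‖v ^ n * x‖ with hw
  have hwg : HasZeroGrowth w :=
    (hu.of_norm_le (v := fun n => ‖u ^ n * x‖) zero_le_one zero_le_one fun n => by simp).add
      (hv.of_norm_le (v := fun n => ‖v ^ n * x‖) zero_le_one zero_le_one fun n => by simp)
  have hpow : ∀ i j, ‖u ^ i * v ^ j‖ ≤ ‖(1 : A)‖ ^ 2 * K ^ (i + j) := by
    intro i j
    calc ‖u ^ i * v ^ j‖ ≤ ‖u ^ i‖ * ‖v ^ j‖ := norm_mul_le _ _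
      _ ≤ (‖(1 : A)‖ * ‖u‖ ^ i) * (‖(1 : A)‖ * ‖v‖ ^ j) := by
        gcongr <;> exact norm_pow_le_norm_one_mul _ _
      _ ≤ (‖(1 : A)‖ * K ^ i) * (‖(1 : A)‖ * K ^ j) := by
        gcongr
        · exact le_max_left _ _
        · exact le_max_right _ _
      _ = _ := by ring
  -- In each term of `(u + v) ^ (2 * n)` one exponent is at least `n`; `n` of those factors are
  -- moved next to `x`, and the other `n` factors cost `K ^ n`.
  have hterm : ∀ n, ∀ m ∈ Finset.HasAntidiagonal.antidiagonal (2 * n),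
      ‖u ^ m.1 * v ^ m.2 * x‖ ≤ ‖(1 : A)‖ ^ 2 * K ^ n * w n := by
    rintro n ⟨i, j⟩ hm
    have hij : i + j = 2 * n := Finset.HasAntidiagonal.mem_antidiagonal.mp hm
    rcases le_or_gt n i with hi | hi
    · obtain ⟨k, rfl⟩ := Nat.exists_eq_add_of_le hi
      have hkj : k + j = n := by omega
      have heq : u ^ (n + k) * v ^ j * x = u ^ k * v ^ j * (u ^ n * x) := by
        rw [add_comm, pow_add, mul_assoc (u ^ k), (huv.pow_pow n j).eq]
        simp only [mul_assoc]
      calc ‖u ^ (n + k) * v ^ j * x‖ ≤ ‖u ^ k * v ^ j‖ * ‖u ^ n * x‖ := by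
            rw [heq]; exact norm_mul_le _ _
        _ ≤ (‖(1 : A)‖ ^ 2 * K ^ n) * w n := by
            gcongr
            · rw [← hkj]; exact hpow k j
            · exact le_add_of_nonneg_right (norm_nonneg _)
    · obtain ⟨k, rfl⟩ := Nat.exists_eq_add_of_le (show n ≤ j by omega)
      have hik : i + k = n := by omega
      have heq : u ^ i * v ^ (n + k) * x = u ^ i * v ^ k * (v ^ n * x) := by
        rw [add_comm n k, pow_add]
        simp only [mul_assoc]
      calc ‖u ^ i * v ^ (n + k) * x‖ ≤ ‖u ^ i * v ^ k‖ * ‖v ^ n * x‖ := by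
            rw [heq]; exact norm_mul_le _ _
        _ ≤ (‖(1 : A)‖ ^ 2 * K ^ n) * w n := by
            gcongr
            · rw [← hik]; exact hpow i k
            · exact le_add_of_nonneg_left (norm_nonneg _)
  have hz0 : 0 < ‖z‖ := norm_pos_iff.mpr hz
  -- Since `(u + v) ^ (2 * n) * x = z ^ (2 * n) • x` and the binomial coefficients sum to `4 ^ n`,
  -- the rate is `4 * K / ‖z‖ ^ 2`.
  refine hwg.eq_zero_of_norm_le (K := ‖(1 : A)‖ ^ 2) (R := 4 * K / ‖z‖ ^ 2)
    (by positivity) (by positivity) fun n => ?_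
  have hw0 : 0 ≤ w n := add_nonneg (norm_nonneg _) (norm_nonneg _)
  have hle : ‖z‖ ^ (2 * n) * ‖x‖ ≤ 2 ^ (2 * n) * (‖(1 : A)‖ ^ 2 * K ^ n * w n) := by
    calc ‖z‖ ^ (2 * n) * ‖x‖ = ‖(u + v) ^ (2 * n) * x‖ := by
          rw [h, ← map_pow, ← Algebra.smul_def, norm_smul, norm_pow]
      _ ≤ ∑ m ∈ Finset.HasAntidiagonal.antidiagonal (2 * n),
            ‖(2 * n).choose m.1 • (u ^ m.1 * v ^ m.2 * x)‖ := by
          rw [huv.add_pow', Finset.sum_mul]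
          simp only [smul_mul_assoc]
          exact norm_sum_le _ _
      _ ≤ ∑ m ∈ Finset.HasAntidiagonal.antidiagonal (2 * n),
            (2 * n).choose m.1 * (‖(1 : A)‖ ^ 2 * K ^ n * w n) := by
          refine Finset.sum_le_sum fun m hm => norm_nsmul_le.trans ?_
          gcongr
          exact hterm n m hm
      _ = _ := by
          have h2 := (Commute.all (1 : ℝ) 1).add_pow' (2 * n)
          simp only [one_pow, mul_one, nsmul_eq_mul] at h2
          rw [← Finset.sum_mul, ← h2]
          norm_num
  rw [Real.norm_of_nonneg hw0, div_pow, mul_pow]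
  rw [pow_mul, pow_mul] at hle
  have h4 : (2 : ℝ) ^ 2 = 4 := by norm_num
  rw [h4] at hle
  calc ‖x‖ ≤ 4 ^ n * (‖(1 : A)‖ ^ 2 * K ^ n * w n) / (‖z‖ ^ 2) ^ n := by
        rw [le_div_iff₀ (by positivity)]; linarith
    _ = _ := by ring

end LocalSpectral

/-! ### The common spectral part. -/

section Main

variable {A : Type*} [NormedRing A]

lemma hasZeroGrowth_sum_pow {ι : Type*} (s : Finset ι) {x : ι → A}
    (hc : ∀ i ∈ s, ∀ j ∈ s, Commute (x i) (x j)) (hx : ∀ i ∈ s, HasZeroGrowth (x i ^ ·)) :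
    HasZeroGrowth ((∑ i ∈ s, x i) ^ ·) := by
  classical
  induction s using Finset.induction_on with
  | empty =>
    simp only [Finset.sum_empty]
    exact hasZeroGrowth_pow_of_isNilpotent IsNilpotent.zero
  | insert i s hi ih =>
    rw [Finset.sum_insert hi]
    exact hasZeroGrowth_pow_add
      (Commute.sum_right _ _ _ fun j hj => hc i (by simp) j (by simp [hj])) (hx i (by simp))
      (ih (fun j hj k hk => hc j (by simp [hj]) k (by simp [hk])) fun j hj => hx j (by simp [hj]))

/-- For an idempotent `p` commuting with `x`, the sequences `(x * p) ^ n` and `x ^ n * p` have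
vanishing growth simultaneously. -/
lemma hasZeroGrowth_mul_idempotent_iff {x p : A} (hp : IsIdempotentElem p) (h : Commute p x) :
    HasZeroGrowth ((x * p) ^ ·) ↔ HasZeroGrowth (fun n => x ^ n * p) := by
  have heq : ∀ n, n ≠ 0 → (x * p) ^ n = x ^ n * p := by
    intro n hn
    rw [h.symm.mul_pow, hp.pow_eq hn]
  constructor
  · intro hx
    refine hx.of_norm_le (norm_nonneg p) zero_le_one fun n => ?_
    have : x ^ n * p = (x * p) ^ n * p := by
      rcases eq_or_ne n 0 with rfl | hn
      · simp
      · rw [heq n hn, mul_assoc, hp.eq]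
    rw [this, one_pow, mul_one, mul_comm ‖p‖]
    exact norm_mul_le _ _
  · intro hx ε hε
    obtain ⟨M, hM⟩ := hx ε hε
    have hM0 : 0 ≤ M := by simpa using (norm_nonneg _).trans (hM 0)
    -- The extra `‖1‖` covers `n = 0`, where `(x * p) ^ 0 = 1` but `x ^ 0 * p = p`.
    refine ⟨M + ‖(1 : A)‖, fun n => ?_⟩
    rcases eq_or_ne n 0 with rfl | hn
    · simpa using hM0
    · simp only [heq n hn, add_mul]
      exact (hM n).trans (le_add_of_nonneg_right (by positivity))

/-- Inserting `1 = ∑ p j` on the free side of `p i * b` or of `b * p i` leaves only the diagonal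
block `p i * b * p i`. -/
lemma commute_of_forall_mul_mul_eq_zero {R ι : Type*} [Ring R] [DecidableEq ι] {s : Finset ι}
    {p : ι → R} (hp : ∑ i ∈ s, p i = 1) {b : R}
    (h : ∀ i ∈ s, ∀ j ∈ s, i ≠ j → p i * b * p j = 0) {i : ι} (hi : i ∈ s) :
    Commute (p i) b := by
  have h1 : p i * b = p i * b * p i := by
    conv_lhs => rw [← mul_one (p i * b), ← hp, Finset.mul_sum]
    exact Finset.sum_eq_single_of_mem i hi fun j hj hji => h i hi j hj hji.symm
  have h2 : b * p i = p i * b * p i := by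
    conv_lhs => rw [← one_mul (b * p i), ← hp, Finset.sum_mul]
    rw [Finset.sum_eq_single_of_mem i hi fun j hj hji => ?_, mul_assoc]
    rw [← mul_assoc]
    exact h j hj i hi hji
  exact h1.trans h2.symm

variable [NormedAlgebra ℂ A] [CompleteSpace A] [Nontrivial A]

/-- Elements at distance zero share a commuting spectral part, a left multiple of `a`. -/
lemma exists_common_spectral_part {a b : A} (ha : (spectrum ℂ a).Finite)
    (hab : specDist a b = 0) : ∃ c : A, Commute c a ∧ Commute c b ∧
      HasZeroGrowth ((a - c) ^ ·) ∧ HasZeroGrowth ((b - c) ^ ·) ∧ ∃ h, c = h * a := by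
  classical
  obtain ⟨h1, h2⟩ := (specDist_eq_zero_iff a b).mp hab
  obtain ⟨p, hidem, hpa, hpp, hsum, hsmall⟩ :=
    exists_idempotents a ha.toFinset ha.coe_toFinset.symm
  set s := ha.toFinset
  have hpaz : ∀ z w, Commute (p z) (a - algebraMap ℂ A w) := fun z w =>
    (hpa z).sub_right (Algebra.commute_algebraMap_right w _)
  have hA : ∀ z ∈ s, HasZeroGrowth (fun n => (a - algebraMap ℂ A z) ^ n * p z) := fun z hz =>
    (hasZeroGrowth_mul_idempotent_iff (hidem z hz) (hpaz z z)).mp (hsmall z hz)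
  have hB : ∀ z ∈ s, HasZeroGrowth (fun n => (b - algebraMap ℂ A z) ^ n * p z) := fun z hz =>
    (hA z hz).sub_algebraMap_transfer z h2
  -- The element `b * p z` lies in the space of `b` at `z`, hence in that of `a`; left
  -- multiplication by `p w`, which commutes with `a`, keeps it there. Since `p w * b * p z` is also
  -- in the space of `a` at `w`, it vanishes.
  have hzero : ∀ w ∈ s, ∀ z ∈ s, w ≠ z → p w * b * p z = 0 := by
    intro w hw z hz hwz
    have hb1 : HasZeroGrowth (fun n => (b - algebraMap ℂ A z) ^ n * (b * p z)) := by
      have hc : ∀ n, (b - algebraMap ℂ A z) ^ n * (b * p z) =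
          b * ((b - algebraMap ℂ A z) ^ n * p z) := by
        intro n
        have hbb : Commute ((b - algebraMap ℂ A z) ^ n) b :=
          ((Commute.refl b).sub_left (Algebra.commute_algebraMap_left z b)).pow_left n
        rw [← mul_assoc, hbb.eq, mul_assoc]
      simp only [hc]
      exact (hB z hz).mul_left b
    have ha1 := (hb1.sub_algebraMap_transfer z h1).mul_left (p w)
    refine eq_zero_of_hasZeroGrowth (u := a - algebraMap ℂ A w) (v := -(a - algebraMap ℂ A z))
      (z := z - w) (sub_ne_zero.mpr hwz.symm) (by rw [map_sub]; abel) ?_ ?_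
    · have := (hA w hw).mul_right (b * p z)
      simpa only [mul_assoc] using this
    · refine ha1.of_norm_le zero_le_one zero_le_one fun n => ?_
      have hc : (-(a - algebraMap ℂ A z)) ^ n * (p w * b * p z) =
          (-1) ^ n * (p w * ((a - algebraMap ℂ A z) ^ n * (b * p z))) := by
        rw [neg_pow, mul_assoc ((-1) ^ n), mul_assoc (p w), ← mul_assoc _ (p w),
          ← ((hpaz w z).pow_right n).eq, mul_assoc (p w)]
      rw [hc]
      rcases neg_one_pow_eq_or A n with h | h <;> simp [h]
  have hpb : ∀ z ∈ s, Commute (p z) b := fun z hz =>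
    commute_of_forall_mul_mul_eq_zero hsum hzero hz
  have hsub : ∀ x : A, x - ∑ z ∈ s, z • p z = ∑ z ∈ s, (x - algebraMap ℂ A z) * p z := by
    intro x
    simp only [sub_mul, Finset.sum_sub_distrib, ← Finset.mul_sum, hsum, mul_one, Algebra.smul_def]
  have hgrowth : ∀ x : A, (∀ z ∈ s, Commute (p z) x) →
      (∀ z ∈ s, HasZeroGrowth (fun n => (x - algebraMap ℂ A z) ^ n * p z)) →
      HasZeroGrowth ((x - ∑ z ∈ s, z • p z) ^ ·) := by
    intro x hx hxz
    have hc : ∀ z ∈ s, ∀ w, Commute (p z) (x - algebraMap ℂ A w) := fun z hz w =>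
      (hx z hz).sub_right (Algebra.commute_algebraMap_right w _)
    rw [hsub]
    refine hasZeroGrowth_sum_pow s (fun z hz w hw => ?_) fun z hz =>
      (hasZeroGrowth_mul_idempotent_iff (hidem z hz) (hc z hz z)).mpr (hxz z hz)
    have hxx : Commute (x - algebraMap ℂ A z) (x - algebraMap ℂ A w) :=
      ((Commute.refl x).sub_right (Algebra.commute_algebraMap_right w x)).sub_left
        (Algebra.commute_algebraMap_left z _)
    exact (hxx.mul_right (hc w hw z).symm).mul_left ((hc z hz w).mul_right (hpp z w))
  refine ⟨∑ z ∈ s, z • p z, Commute.sum_left _ _ _ fun z _ => (hpa z).smul_left z,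
    Commute.sum_left _ _ _ fun z hz => (hpb z hz).smul_left z,
    hgrowth a (fun z _ => hpa z) hA, hgrowth b hpb hB, ?_⟩
  -- For `z ≠ 0` the element `z + (a - z) * p z` is invertible and acts as `a` on `p z`, so `p z` is
  -- a left multiple of `a`; the term for `z = 0` drops out of `c`.
  have hmul : ∀ z ∈ s, ∃ h, z • p z = h * a := by
    intro z hz
    rcases eq_or_ne z 0 with rfl | hz0
    · exact ⟨0, by simp⟩
    · obtain ⟨v, hv⟩ := (isUnit_algebraMap_add (hsmall z hz) hz0).exists_left_inv
      have hvp : (algebraMap ℂ A z + (a - algebraMap ℂ A z) * p z) * p z = a * p z := by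
        rw [add_mul, mul_assoc, (hidem z hz).eq, sub_mul]
        abel
      refine ⟨z • (v * p z), ?_⟩
      rw [smul_mul_assoc, mul_assoc, (hpa z).eq, ← hvp, ← mul_assoc, hv, one_mul]
  choose! h hh using hmul
  exact ⟨∑ z ∈ s, h z, by rw [Finset.sum_mul]; exact Finset.sum_congr rfl hh⟩

end Main

/-! ### Chain conditions and the socle. -/

section Socle

/-- An element of a sum of minimal left ideals already lies in a finite subsum, and finite sums of
simple modules satisfy both chain conditions. -/
lemma exists_finiteLength_of_mem_socle {A : Type*} [Ring A] {a : A} (ha : a ∈ socle A) :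
    ∃ L : Ideal A, a ∈ L ∧ IsArtinian A L ∧ IsNoetherian A L := by
  obtain ⟨s, hs, has⟩ := Submodule.mem_sSup_iff_exists_finset.mp ha
  have hsimple : ∀ I : s, IsSimpleModule A (I : Ideal A) := fun I =>
    isSimpleModule_iff_isAtom.mpr (hs I.2)
  rw [iSup_subtype'] at has
  exact ⟨_, has, isArtinian_iSup, isNoetherian_iSup⟩

variable {A : Type*} [NormedRing A]

/-- In an Artinian left ideal, vanishing growth of the powers forces nilpotency. -/
lemma isNilpotent_of_hasZeroGrowth {a : A} {L : Ideal A} (haL : a ∈ L) [IsArtinian A L]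
    (h : HasZeroGrowth (a ^ ·)) : IsNilpotent a := by
  have hmono : ∀ n m, n ≤ m → Ideal.span {a ^ (m + 1)} ≤ Ideal.span {a ^ (n + 1)} := by
    intro n m hnm
    rw [Ideal.span_singleton_le_iff_mem, Ideal.mem_span_singleton']
    exact ⟨a ^ (m - n), by rw [← pow_add]; congr 1; omega⟩
  -- The descending chain of left ideals generated by `a ^ (n + 1)`, cut down to `L`. The shift
  -- excludes `a ^ 0 = 1`, which need not lie in `L`.
  obtain ⟨n, hn⟩ := IsArtinian.monotone_stabilizes
    (⟨fun n => OrderDual.toDual (Submodule.comap L.subtype (Ideal.span {a ^ (n + 1)})),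
      fun n m hnm => Submodule.comap_mono (hmono n m hnm)⟩ : ℕ →o (Submodule A L)ᵒᵈ)
  have hmem : a ^ (n + 1) ∈ L := by
    rw [pow_succ]; exact L.mul_mem_left _ haL
  have h1 : (⟨a ^ (n + 1), hmem⟩ : L) ∈ Submodule.comap L.subtype (Ideal.span {a ^ (n + 1)}) :=
    Ideal.mem_span_singleton_self _
  have heq : Submodule.comap L.subtype (Ideal.span {a ^ (n + 1)}) =
    Submodule.comap L.subtype (Ideal.span {a ^ (n + 1 + 1)}) := hn (n + 1) (Nat.le_succ n)
  rw [heq] at h1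
  obtain ⟨g, hg⟩ := Ideal.mem_span_singleton'.mp (Submodule.mem_comap.mp h1)
  simp only [Submodule.subtype_apply] at hg
  refine ⟨n + 1, ?_⟩
  -- Stabilization gives `a ^ (n + 1) = g * a ^ (n + 2)`. Iterating it puts arbitrarily high powers
  -- of `a` on the right, whose vanishing growth beats `‖g‖ ^ k`.
  have hk : ∀ k, a ^ (n + 1) = g ^ k * a ^ (n + 1) * a ^ k := by
    intro k
    induction k with
    | zero => simp
    | succ k ih =>
      conv_lhs => rw [ih, ← hg]
      rw [pow_succ g, pow_succ' a k, pow_succ a (n + 1)]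
      simp only [mul_assoc]
  refine h.eq_zero_of_norm_le (K := ‖(1 : A)‖ * ‖a ^ (n + 1)‖) (R := ‖g‖) (by positivity)
    (by positivity) fun k => ?_
  calc ‖a ^ (n + 1)‖ = ‖g ^ k * a ^ (n + 1) * a ^ k‖ := by rw [← hk k]
    _ ≤ ‖g ^ k‖ * ‖a ^ (n + 1)‖ * ‖a ^ k‖ :=
      (norm_mul_le _ _).trans (by gcongr; exact norm_mul_le _ _)
    _ ≤ (‖(1 : A)‖ * ‖g‖ ^ k) * ‖a ^ (n + 1)‖ * ‖a ^ k‖ := by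
      gcongr; exact norm_pow_le_norm_one_mul g k
    _ = _ := by ring

lemma isNilpotent_of_mem_socle {a : A} (ha : a ∈ socle A) (h : HasZeroGrowth (a ^ ·)) :
    IsNilpotent a := by
  obtain ⟨L, haL, _, _⟩ := exists_finiteLength_of_mem_socle ha
  exact isNilpotent_of_hasZeroGrowth haL h

variable [NormedAlgebra ℂ A]

/-- Nonzero spectral values of an element of an Artinian left ideal are eigenvalues. -/
lemma exists_eigenvector {a : A} {L : Ideal A} (haL : a ∈ L) [IsArtinian A L] {z : ℂ}
    (hz0 : z ≠ 0) (hz : z ∈ spectrum ℂ a) : ∃ y ∈ L, y ≠ 0 ∧ y * (a - algebraMap ℂ A z) = 0 := by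
  by_contra! hno
  have hL : ∀ x ∈ L, LinearMap.toSpanSingleton A A (a - algebraMap ℂ A z) x ∈ L := by
    intro x hx
    rw [LinearMap.toSpanSingleton_apply, smul_eq_mul, mul_sub,
      ← (Algebra.commute_algebraMap_left z x).eq]
    exact L.sub_mem (L.mul_mem_left _ haL) (L.mul_mem_left _ hx)
  set φ : L →ₗ[A] L := (LinearMap.toSpanSingleton A A (a - algebraMap ℂ A z)).restrict hL
  have hφ : ∀ x : L, (φ x : A) = x * (a - algebraMap ℂ A z) := fun x => rfl
  have hinj : Function.Injective φ := by
    rw [injective_iff_map_eq_zero]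
    intro x hx
    by_contra hx0
    refine hno x x.2 (fun h => hx0 (Subtype.ext h)) ?_
    rw [← hφ, hx]; rfl
  -- Without eigenvectors, right multiplication by `r = a - z` is injective on `L`, hence onto.
  -- Solving `x * r = a` gives `(x - 1) * r = z`, a left inverse of `r` up to the scalar `z`.
  obtain ⟨x, hx⟩ := IsArtinian.surjective_of_injective_endomorphism φ hinj ⟨a, haL⟩
  have hxa : (x : A) * (a - algebraMap ℂ A z) = a := by rw [← hφ, hx]
  set r := a - algebraMap ℂ A z with hr
  have hleft : ((x : A) - 1) * r = algebraMap ℂ A z := by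
    rw [sub_mul, hxa, one_mul, hr]; abel
  -- The left inverse is two-sided: the defect `r * (x - 1) - z` lies in `L` and is killed by `r` on
  -- the right.
  have hright : r * ((x : A) - 1) = algebraMap ℂ A z := by
    have hmem : r * ((x : A) - 1) - algebraMap ℂ A z ∈ L := by
      have : r * ((x : A) - 1) - algebraMap ℂ A z = r * x - a := by
        rw [mul_sub, mul_one, hr]; abel
      rw [this]
      exact L.sub_mem (L.mul_mem_left _ x.2) haL
    by_contra hne
    refine hno _ hmem (sub_ne_zero.mpr hne) ?_
    rw [sub_mul, mul_assoc, hleft, (Algebra.commute_algebraMap_right z r).eq, sub_self]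
  have hone : algebraMap ℂ A z⁻¹ * algebraMap ℂ A z = 1 := by
    rw [← map_mul, inv_mul_cancel₀ hz0, map_one]
  refine hz ?_
  rw [spectrum.mem_resolventSet_iff, ← IsUnit.neg_iff, neg_sub]
  refine ⟨⟨r, algebraMap ℂ A z⁻¹ * ((x : A) - 1), ?_, ?_⟩, rfl⟩
  · rw [← mul_assoc, (Algebra.commute_algebraMap_right z⁻¹ r).eq, mul_assoc, hright, hone]
  · rw [mul_assoc, hleft, hone]

/-- Modulo `X - C z`, the polynomial `f` equals the constant `f.eval z`. -/
lemma mul_aeval_of_eigenvector {a y : A} {z : ℂ} (h : y * (a - algebraMap ℂ A z) = 0)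
    (f : ℂ[X]) : y * aeval a f = f.eval z • y := by
  have hdvd : X - C z ∣ f - C (f.eval z) := by
    rw [dvd_iff_isRoot]; simp
  obtain ⟨q, hq⟩ := hdvd
  have h1 : y * aeval a (f - C (f.eval z)) = 0 := by
    rw [hq, map_mul, ← mul_assoc]
    simp [h]
  rw [map_sub, aeval_C, mul_sub, sub_eq_zero] at h1
  rw [h1, ← (Algebra.commute_algebraMap_left _ y).eq, Algebra.smul_def]

/-- An element of a left ideal of finite length has finite spectrum. -/
lemma finite_spectrum {a : A} {L : Ideal A} (haL : a ∈ L) [IsArtinian A L] [IsNoetherian A L] :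
    (spectrum ℂ a).Finite := by
  by_contra hinf
  have hinf' : (spectrum ℂ a \ {0}).Infinite := Set.Infinite.sdiff hinf (Set.finite_singleton 0)
  set g := hinf'.natEmbedding
  -- Infinitely many nonzero spectral values `g i` would give a strictly ascending chain in `L`, the
  -- left annihilators of `F n` evaluated at `a`: an eigenvector for `g n` is killed at `n + 1` but
  -- not at `n`.
  set F : ℕ → ℂ[X] := fun n => ∏ i ∈ Finset.range n, (X - C (g i : ℂ)) with hF
  have hmono : ∀ n m, n ≤ m → LinearMap.ker (LinearMap.toSpanSingleton A A (aeval a (F n))) ≤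
      LinearMap.ker (LinearMap.toSpanSingleton A A (aeval a (F m))) := by
    intro n m hnm x hx
    obtain ⟨q, hq⟩ : F n ∣ F m := Finset.prod_dvd_prod_of_subset _ _ _ (Finset.range_mono hnm)
    simp only [LinearMap.mem_ker, LinearMap.toSpanSingleton_apply, smul_eq_mul] at hx ⊢
    rw [hq, map_mul, ← mul_assoc, hx, zero_mul]
  obtain ⟨n, hn⟩ := monotone_stabilizes_iff_noetherian.mpr ‹IsNoetherian A L›
    ⟨fun n => (LinearMap.ker (LinearMap.toSpanSingleton A A (aeval a (F n)))).comap L.subtype,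
      fun n m hnm => Submodule.comap_mono (hmono n m hnm)⟩
  obtain ⟨y, hyL, hy0, hy⟩ := exists_eigenvector haL (g n).2.2 (g n).2.1
  have hmem : (⟨y, hyL⟩ : L) ∈
      (LinearMap.ker (LinearMap.toSpanSingleton A A (aeval a (F (n + 1))))).comap L.subtype := by
    simp only [Submodule.mem_comap, Submodule.subtype_apply, LinearMap.mem_ker,
      LinearMap.toSpanSingleton_apply, smul_eq_mul]
    rw [mul_aeval_of_eigenvector hy, hF]
    simp [Finset.prod_range_succ]
  have heq : (LinearMap.ker (LinearMap.toSpanSingleton A A (aeval a (F n)))).comap L.subtype =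
    (LinearMap.ker (LinearMap.toSpanSingleton A A (aeval a (F (n + 1))))).comap L.subtype :=
      hn (n + 1) (Nat.le_succ n)
  rw [← heq] at hmem
  simp only [Submodule.mem_comap, Submodule.subtype_apply, LinearMap.mem_ker,
      LinearMap.toSpanSingleton_apply, smul_eq_mul] at hmem
  rw [mul_aeval_of_eigenvector hy, smul_eq_zero_iff_left hy0, hF, eval_prod,
    Finset.prod_eq_zero_iff] at hmem
  obtain ⟨i, hi, h0⟩ := hmem
  simp only [eval_sub, eval_X, eval_C, sub_eq_zero] at h0
  have := g.injective (Subtype.ext h0)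
  exact (Finset.mem_range.mp hi).ne' this

lemma finite_spectrum_of_mem_socle {a : A} (ha : a ∈ socle A) : (spectrum ℂ a).Finite := by
  obtain ⟨L, haL, _, _⟩ := exists_finiteLength_of_mem_socle ha
  exact finite_spectrum haL

end Socle

end SpectralSemidistance

/-! ### The two characterizations. -/

theorem mainTheorem7 {A : Type*} [NormedRing A] [NormedAlgebra ℂ A] [CompleteSpace A]
    [Nontrivial A] :
    (∀ a b : A, (spectrum ℂ a).Finite →
      (SpectralSemidistance.specDist a b = 0 ↔
        ∃ c : A, Commute c a ∧ Commute c b ∧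
          SpectralSemidistance.IsQuasinilpotent (a - c) ∧
          SpectralSemidistance.IsQuasinilpotent (b - c))) ∧
    (Ring.jacobson A = ⊥ →
      ∀ a ∈ SpectralSemidistance.socle A, ∀ b ∈ SpectralSemidistance.socle A,
        (SpectralSemidistance.specDist a b = 0 ↔
          ∃ c ∈ SpectralSemidistance.socle A, Commute c a ∧ Commute c b ∧
            IsNilpotent (a - c) ∧ IsNilpotent (b - c))) := by
  open SpectralSemidistance in
  refine ⟨fun a b hfin => ⟨fun h => ?_, ?_⟩, fun _ a ha b hb => ⟨fun h => ?_, ?_⟩⟩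
  · obtain ⟨c, hca, hcb, h1, h2, -⟩ := exists_common_spectral_part hfin h
    exact ⟨c, hca, hcb, isQuasinilpotent_iff.mpr h1, isQuasinilpotent_iff.mpr h2⟩
  · rintro ⟨c, hca, hcb, h1, h2⟩
    exact specDist_eq_zero_of_commute hca hcb (isQuasinilpotent_iff.mp h1)
      (isQuasinilpotent_iff.mp h2)
  · obtain ⟨c, hca, hcb, h1, h2, g, hg⟩ :=
      exists_common_spectral_part (finite_spectrum_of_mem_socle ha) h
    have hc : c ∈ socle A := hg ▸ (socle A).mul_mem_left g ha
    exact ⟨c, hc, hca, hcb, isNilpotent_of_mem_socle ((socle A).sub_mem ha hc) h1,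
      isNilpotent_of_mem_socle ((socle A).sub_mem hb hc) h2⟩
  · rintro ⟨c, -, hca, hcb, h1, h2⟩
    exact specDist_eq_zero_of_commute hca hcb (hasZeroGrowth_pow_of_isNilpotent h1)
      (hasZeroGrowth_pow_of_isNilpotent h2)
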